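/- Let $G=(V,E)$ be a finite connected simple graph and let $D(G)=\{(u,v),(v,u)\mid uv\in E\}$ be the set of its arcs, i.e. the arc set of its symmetric digraph; for $e=(u,v)\in D(G)$ put $o(e)=u$, $t(e)=v$, $e^{-1}=(v,u)$. Let $\Gamma$ be a finite group, $\alpha:D(G)\to\Gamma$ an ordinary voltage assignment, i.e. $\alpha(e^{-1})=\alpha(e)^{-1}$ for all $e\in D(G)$, and $\rho:\Gamma\to U(d)$ a unitary representation of degree $d$. A cycle of $G$ is a sequence $C=(e_1,\dots,e_n)$ of $n=|C|\ge 1$ arcs with $t(e_i)=o(e_{i+1})$, indices mod $n$; it is reduced if $e_{i+1}^{-1}\ne e_i$ for all $i$ mod $n$, and prime if it is not a multiple $B^r$ of a strictly shorter cycle $B$. An alternating walk is a sequence $[e_1,\dots,e_r]$ of arcs for which there are vertices $v_0,\dots,v_r$ such that the arcs $e_i$ are alternately $(v_{i-1},v_i)$ and $(v_i,v_{i-1})$; it starts with an out-edge if $e_1=(v_0,v_1)$ and with an in-edge if $e_1=(v_1,v_0)$. It is an alternating cycle if $r\ge 1$, $v_0=v_r$, and $o(e_1)=o(e_r)=v_0$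 or $t(e_1)=t(e_r)=v_0$ (so that $r$ is even); such a cycle is reduced if $e_{i+1}\neq e_i$ for $1\le i<r$ and $e_r\ne e_1$, and prime if it is not a multiple of a strictly shorter alternating cycle. Two cycles (alternating cycles) are equivalent if they differ by a cyclic rotation; $[C]$ denotes the equivalence class of $C$. The Ihara $L$-function of $G$ is $$\mathbf Z(G,\rho,\alpha,t)=\prod_{[C]}\det\bigl(I_d-\rho(\alpha(e_1))\cdots\rho(\alpha(e_n))\,t^{|C|}\bigr)^{-1},$$ where $[C]$ runs over the classes of prime, reduced cycles $C=(e_1,\dots,e_n)$ of $G$. The alternating $L$-function of $G$ is $$\mathbf Z_a(G,\rho,\alpha,t)=\prod_{[C]}\det\bigl(I_d-\rho(\alpha(e_1))\rho(\alpha(e_2))^{-1}\cdots\rho(\alpha(e_{2r-1}))\rho(\alpha(e_{2r}))^{-1}\,t^{|C|}\bigr)^{-1},$$ where $[C]$ runs over the classes of prime, reduced alternating cycles and the representative $C=[e_1,\dots,e_{2r}]$ is one that starts with an out-edge. Then $$\mathbf Z_a(G,\rho,\alpha,t)=\mathbf Z(G,\rho,\alpha,t)\,\mathbf Z(G,\rho,\alpha,-t).$$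 This holds for all complex $t$ in some neighbourhood of $0$, in which all three products converge unconditionally, and also as an identity in $\mathbb C[[t]]$, in which the three products converge coefficientwise. -/

import Mathlib

open scoped PowerSeries.WithPiTopology

namespace SimpleGraph

variable {V : Type*} {G : SimpleGraph V}

/-! ### Cycles of a graph

An arc of `G` is a dart `e : G.Dart` with origin `e.fst`, terminus `e.snd` and inverse `e.symm`;
`G.Dart` is the arc set of the symmetric digraph of `G`. Paths and alternating walks are lists of
arcs. -/

/-- `C = (e₁, …, eₙ)`, `n ≥ 1`, is a cycle (closed path): `t(eᵢ) = o(eᵢ₊₁)`, indices mod `n`.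
(`G.DartAdj e f` says `e.snd = f.fst`.) -/
def IsClosedPath (C : List G.Dart) : Prop :=
  C ≠ [] ∧ (C : Cycle G.Dart).Chain G.DartAdj

/-- `P` has no two consecutive arcs `eᵢ, eᵢ₊₁` with `eᵢ₊₁⁻¹ = eᵢ`. -/
def NoBacktracking (P : List G.Dart) : Prop :=
  P.IsChain fun e f => f.symm ≠ e

/-- A cycle `C` is reduced if neither `C` nor `C²` has a backtracking. -/
def IsReducedCycle (C : List G.Dart) : Prop :=
  IsClosedPath C ∧ NoBacktracking C ∧ NoBacktracking (C ++ C)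

/-- The list `B` repeated `r` times. -/
def listPow {A : Type*} (B : List A) (r : ℕ) : List A :=
  (List.replicate r B).flatten

/-- A prime, reduced cycle: reduced, and not a multiple of a strictly smaller cycle. -/
def IsPrimeReducedCycle (C : List G.Dart) : Prop :=
  IsReducedCycle C ∧
    ¬ ∃ (B : List G.Dart) (r : ℕ), IsClosedPath B ∧ B.length < C.length ∧ C = listPow B r

variable (G) in
/-- Equivalence classes `[C]` of prime, reduced cycles. `Cycle G.Dart` is the type of lists of arcs
up to cyclic rotation. -/
def PrimeCycleClass : Type _ :=
  {c : Cycle G.Dart // ∃ C : List G.Dart, (C : Cycle G.Dart) = c ∧ IsPrimeReducedCycle C}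

/-- A prime, reduced cycle representing the class. -/
noncomputable def PrimeCycleClass.rep (c : PrimeCycleClass G) : List G.Dart :=
  c.2.choose

/-! ### Alternating cycles of the symmetric digraph of a graph -/

/-- The endpoint of `e` at which it is entered when it is traversed forwards (`b = true`) or
backwards (`b = false`). -/
def altStart (b : Bool) (e : G.Dart) : V := if b then e.fst else e.snd

/-- The endpoint of `e` at which it is left when it is traversed forwards (`b = true`) or
backwards (`b = false`). -/
def altEnd (b : Bool) (e : G.Dart) : V := if b then e.snd else e.fst

/-- `IsAltWalk b u w [e₁, …, eᵣ]`: the arcs form a `(u,w)`-alternating walk, starting with an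
out-edge if `b = true` and with an in-edge if `b = false`; consecutive arcs are traversed in
opposite senses. -/
def IsAltWalk : Bool → V → V → List G.Dart → Prop
  | _, u, w, [] => u = w
  | b, u, w, e :: l => altStart b e = u ∧ IsAltWalk (!b) (altEnd b e) w l

/-- A `v`-alternating cycle starting with an out-edge (`b = true`) or in-edge (`b = false`): a
non-empty closed alternating walk `[e₁, …, eᵣ]` at `v` such that `o(e₁) = o(eᵣ) = v` or
`t(e₁) = t(eᵣ) = v`. -/
def IsAltCycleAt (b : Bool) (v : V) (C : List G.Dart) : Prop :=
  IsAltWalk b v v C ∧ ∃ h : C ≠ [],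
    ((C.head h).fst = v ∧ (C.getLast h).fst = v) ∨ ((C.head h).snd = v ∧ (C.getLast h).snd = v)

/-- An alternating cycle. -/
def IsAltCycle (C : List G.Dart) : Prop :=
  ∃ b v, IsAltCycleAt b v C

/-- An alternating cycle starting with an out-edge, i.e. `o(C) = o(e₁)`. -/
def IsOutAltCycle (C : List G.Dart) : Prop :=
  ∃ v, IsAltCycleAt true v C

/-- An alternating cycle is reduced if it has neither a backtracking (`eᵢ₊₁ = eᵢ`) nor a tail
(`eᵣ = e₁`). -/
def IsReducedAltCycle (C : List G.Dart) : Prop :=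
  IsAltCycle C ∧ C.IsChain (fun e f => f ≠ e) ∧ ∀ h : C ≠ [], C.getLast h ≠ C.head h

/-- A prime, reduced alternating cycle: reduced, and not a multiple of a strictly smaller
alternating cycle. -/
def IsPrimeReducedAltCycle (C : List G.Dart) : Prop :=
  IsReducedAltCycle C ∧
    ¬ ∃ (B : List G.Dart) (r : ℕ), IsAltCycle B ∧ B.length < C.length ∧ C = listPow B r

variable (G) in
/-- Equivalence classes `[C]` of prime, reduced alternating cycles. -/
def PrimeAltCycleClass : Type _ :=
  {c : Cycle G.Dart // ∃ C : List G.Dart, (C : Cycle G.Dart) = c ∧ IsPrimeReducedAltCycle C}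

theorem isAltWalk_append_singleton (b : Bool) (u w : V) (l : List G.Dart) (e : G.Dart) :
    IsAltWalk b u w (l ++ [e]) ↔
      IsAltWalk b u (altStart (b ^^ decide (Odd l.length)) e) l ∧
        altEnd (b ^^ decide (Odd l.length)) e = w := by
  induction l generalizing b u with
  | nil => simp [IsAltWalk, eq_comm]
  | cons f l ih =>
    have h : ((!b) ^^ decide (Odd l.length)) = (b ^^ decide (Odd (f :: l).length)) := by
      rcases Nat.even_or_odd l.length with h | h
      · have h' : ¬ Odd l.length := by simpa using h
        have h2 : Odd (l.length + 1) := h.add_one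
        cases b <;> simp [h', h2]
      · have h2 : ¬ Odd (l.length + 1) := by simpa using h.add_one
        cases b <;> simp [h, h2]
    simp only [List.cons_append, IsAltWalk, ih, h, and_assoc]

/-- Every class of alternating cycles has a representative that starts with an out-edge. -/
theorem IsAltCycle.exists_out {C : List G.Dart} (hC : IsAltCycle C) :
    ∃ C' : List G.Dart, (C' : Cycle G.Dart) = C ∧ IsOutAltCycle C' := by
  obtain ⟨b, v, hw, hne, hcl⟩ := hC
  cases b with
  | true => exact ⟨C, rfl, v, hw, hne, hcl⟩
  | false =>
    obtain _ | ⟨e, l⟩ := C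
    · exact absurd rfl hne
    simp only [IsAltWalk, altStart, altEnd, Bool.false_eq_true, if_false, Bool.not_false] at hw
    obtain ⟨hev, hl⟩ := hw
    have loopless (f : G.Dart) : f.fst ≠ f.snd := f.fst_ne_snd
    have hcl' : ((e :: l).getLast hne).snd = v := by
      rcases hcl with h | h
      · exact absurd (h.1.trans hev.symm) (loopless e)
      · exact h.2
    rcases List.eq_nil_or_concat' l with rfl | ⟨l', f, rfl⟩
    · exact absurd (hl.trans hev.symm) (loopless e)
    have hf : f.snd = v := by simpa using hcl'
    have hodd : ¬ Odd l'.length := by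
      intro h
      have := ((isAltWalk_append_singleton _ _ _ _ _).1 hl).2
      simp only [h, decide_true, Bool.xor_self, altEnd, Bool.false_eq_true, if_false] at this
      exact loopless f (this.trans hf.symm)
    have hodd' : Odd (l' ++ [f]).length := by
      simpa using (Nat.not_odd_iff_even.1 hodd).add_one
    refine ⟨(l' ++ [f]) ++ [e], (Cycle.coe_cons_eq_coe_append _ _).symm, e.fst, ?_, by simp,
      Or.inl ⟨?_, by simp⟩⟩
    · rw [isAltWalk_append_singleton]
      simp only [hodd', decide_true, Bool.xor_self, altStart, altEnd, Bool.false_eq_true, if_false]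
      exact ⟨hev ▸ hl, trivial⟩
    · obtain _ | ⟨g, l''⟩ := l'
      · simpa [IsAltWalk, altStart] using hl.1
      · simpa [IsAltWalk, altStart] using hl.1

theorem PrimeAltCycleClass.exists_out (c : PrimeAltCycleClass G) :
    ∃ C : List G.Dart, (C : Cycle G.Dart) = c.1 ∧ IsOutAltCycle C := by
  obtain ⟨c, C, rfl, hC⟩ := c
  exact hC.1.1.exists_out

/-- A representative `C = [e₁, …, e₂ᵣ]` of the class that starts with an out-edge:
`o(C) = o(e₁)`. -/
noncomputable def PrimeAltCycleClass.rep (c : PrimeAltCycleClass G) : List G.Dart :=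
  c.exists_out.choose

/-! ### Voltages and `L`-functions -/

/-- `α` is an ordinary voltage assignment: `α(e⁻¹) = α(e)⁻¹` for all arcs `e`. -/
def IsOrdinaryVoltage {Γ : Type*} [Group Γ] (α : G.Dart → Γ) : Prop :=
  ∀ e : G.Dart, α e.symm = (α e)⁻¹

/-- The Euler factor `det(I_d - M tⁿ)⁻¹`, for a complex matrix `M` and `t` in a commutative
`ℂ`-algebra `R`. It is used for a complex number `t` (`R = ℂ`) and for an indeterminate
(`R = ℂ⟦X⟧`, `t = X`). -/
noncomputable def eulerFactor {R : Type*} [CommRing R] [Algebra ℂ R] {d : ℕ}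
    (M : Matrix (Fin d) (Fin d) ℂ) (n : ℕ) (t : R) : R :=
  Ring.inverse (1 - t ^ n • M.map (algebraMap ℂ R)).det

section LFunctions

variable {Γ : Type*} [Group Γ] {d : ℕ} {R : Type*} [CommRing R] [Algebra ℂ R]

/-- `ρ(α(C)) = ρ(α(e₁)) ⋯ ρ(α(eᵣ))`. -/
def cycleHolonomy (ρ : Γ →* Matrix.unitaryGroup (Fin d) ℂ) (α : G.Dart → Γ) (C : List G.Dart) :
    Matrix.unitaryGroup (Fin d) ℂ :=
  (C.map fun e => ρ (α e)).prod

/-- `ρ(α(e₁)) ρ(α(e₂))⁻¹ ⋯ ρ(α(e₂ᵣ₋₁)) ρ(α(e₂ᵣ))⁻¹`. -/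
def altHolonomy (ρ : Γ →* Matrix.unitaryGroup (Fin d) ℂ) (α : G.Dart → Γ) (C : List G.Dart) :
    Matrix.unitaryGroup (Fin d) ℂ :=
  (C.map fun e => ρ (α e)).alternatingProd

/-- The factor of the Ihara `L`-function at a class of prime, reduced cycles. -/
noncomputable def iharaFactor (ρ : Γ →* Matrix.unitaryGroup (Fin d) ℂ) (α : G.Dart → Γ) (t : R)
    (c : PrimeCycleClass G) : R :=
  eulerFactor (cycleHolonomy ρ α c.rep : Matrix (Fin d) (Fin d) ℂ) c.rep.length t

/-- The factor of the alternating `L`-function at a class of prime, reduced alternating cycles. -/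
noncomputable def altFactor (ρ : Γ →* Matrix.unitaryGroup (Fin d) ℂ) (α : G.Dart → Γ) (t : R)
    (c : PrimeAltCycleClass G) : R :=
  eulerFactor (altHolonomy ρ α c.rep : Matrix (Fin d) (Fin d) ℂ) c.rep.length t

/-- The Ihara `L`-function `Z(G, ρ, α, t)`. -/
noncomputable def iharaL [TopologicalSpace R] (ρ : Γ →* Matrix.unitaryGroup (Fin d) ℂ)
    (α : G.Dart → Γ) (t : R) : R :=
  ∏' c : PrimeCycleClass G, iharaFactor ρ α t c

/-- The alternating `L`-function `Z_a(G, ρ, α, t)`. -/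
noncomputable def altL [TopologicalSpace R] (ρ : Γ →* Matrix.unitaryGroup (Fin d) ℂ)
    (α : G.Dart → Γ) (t : R) : R :=
  ∏' c : PrimeAltCycleClass G, altFactor ρ α t c

end LFunctions

end SimpleGraph

/-! Reversing every other arc turns a closed walk of even length into an alternating cycle, and a
backtracking into two equal consecutive arcs. A prime reduced cycle of even length `n` gives two
classes of alternating cycles of length `n`, according to which arcs are reversed; for odd `n` only
the double cycle can be alternated, giving one class of length `2n`. By `altEquiv` these are all the
classes of prime reduced alternating cycles, each once.

Since `α(e⁻¹) = α(e)⁻¹`, the alternating holonomy is conjugate to `M` or `M ^ 2`, where `M` is the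
holonomy of the cycle. For even `n` the two equal factors are the Ihara factors at `t` and `-t`; for
odd `n`, `det(1 - M²t²ⁿ) = det(1 - Mtⁿ) det(1 + Mtⁿ)`. So `prod_altFactor_toAlt` proves the identity
class by class, and `altL_eq_of_multipliable` regroups the product.

Cycles are handled as periodic sequences of arcs: rotation is a shift, and primeness says that the
length is the least period. The key fact is `IsNonBacktracking.ne_symm`: it excludes odd periods and
odd shifts between alternations.

Convergence rests on there being finitely many words of each length: a factor at length `n` is `1`
modulo `Xⁿ`, and for small complex `t` it differs from `1` by at most a constant times `‖t‖ⁿ`,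
uniformly because `Γ` is finite. -/

namespace SimpleGraph

/-! ### Words read off a periodic sequence -/

section Words

variable {A : Type*}

/-- The word `s 0, …, s (n - 1)`. -/
def word (s : ℕ → A) (n : ℕ) : List A := (List.range n).map s

@[simp] theorem length_word (s : ℕ → A) (n : ℕ) : (word s n).length = n := by simp [word]

theorem word_succ (s : ℕ → A) (n : ℕ) : word s (n + 1) = word s n ++ [s n] := by
  simp [word, List.range_succ]

theorem word_add (s : ℕ → A) (m n : ℕ) :
    word s (m + n) = word s m ++ word (fun i => s (i + m)) n := by
  simp [word, List.range_add, Function.comp_def, add_comm]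

theorem word_succ' (s : ℕ → A) (n : ℕ) : word s (n + 1) = s 0 :: word (fun i => s (i + 1)) n := by
  rw [add_comm, word_add]; rfl

theorem getElem_word (s : ℕ → A) (n i : ℕ) (h : i < (word s n).length) : (word s n)[i] = s i := by
  simp [word]

theorem word_ne_nil (s : ℕ → A) {n : ℕ} (hn : 0 < n) : word s n ≠ [] := by
  rw [← List.length_pos_iff]; simpa using hn

theorem exists_eq_word {C : List A} (hC : C ≠ []) :
    ∃ s : ℕ → A, Function.Periodic s C.length ∧ C = word s C.length := by
  have hpos := List.length_pos_iff.2 hC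
  refine ⟨fun i => C[i % C.length]'(Nat.mod_lt _ hpos), fun i => by simp, ?_⟩
  refine List.ext_getElem (by simp) fun i h₁ h₂ => ?_
  simp [getElem_word, Nat.mod_eq_of_lt h₁]

theorem periodic_shift {s : ℕ → A} {n : ℕ} (hs : Function.Periodic s n) (k : ℕ) :
    Function.Periodic (fun i => s (i + k)) n := fun i => by
  simpa only [add_right_comm] using hs (i + k)

theorem periodic_of_shift {s : ℕ → A} {n m : ℕ} (hn : 0 < n) (hs : Function.Periodic s n) {k : ℕ}
    (h : Function.Periodic (fun i => s (i + k)) m) : Function.Periodic s m := fun i => by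
  -- A further shift by `l` completes the shift by `k` to a multiple of the period `n`, which undoes
  -- it.
  obtain ⟨l, hl⟩ : ∃ l, k * n = l + k :=
    ⟨k * n - k, (Nat.sub_add_cancel (Nat.le_mul_of_pos_right k hn)).symm⟩
  have hp := hs.nat_mul k
  simp only [Nat.cast_id] at hp
  have := h (i + l)
  simp only at this
  rw [← hp (i + m), ← hp i, hl]
  convert this using 2 <;> ring

theorem periodic_mod {s : ℕ → A} {n k : ℕ} (hs : Function.Periodic s n)
    (hk : Function.Periodic s k) : Function.Periodic s (k % n) := fun i => by
  have hp := hs.nat_mul (k / n)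
  simp only [Nat.cast_id] at hp
  rw [← hp (i + k % n), add_assoc, mul_comm, Nat.mod_add_div, hk]

/-- `n` is the least positive period of `s`. -/
structure IsLeastPeriod (s : ℕ → A) (n : ℕ) : Prop where
  pos : 0 < n
  periodic : Function.Periodic s n
  le : ∀ k, 0 < k → Function.Periodic s k → n ≤ k

theorem IsLeastPeriod.dvd {s : ℕ → A} {n k : ℕ} (h : IsLeastPeriod s n)
    (hk : Function.Periodic s k) : n ∣ k := by
  by_contra hd
  have h0 : 0 < k % n := Nat.pos_of_ne_zero fun h0 => hd (Nat.dvd_of_mod_eq_zero h0)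
  exact absurd (h.le _ h0 (periodic_mod h.periodic hk)) (not_le.2 (Nat.mod_lt _ h.pos))

theorem exists_isLeastPeriod {s : ℕ → A} {n : ℕ} (hn : 0 < n) (hs : Function.Periodic s n) :
    ∃ m, IsLeastPeriod s m := by
  classical
  have hex : ∃ m, 0 < m ∧ Function.Periodic s m := ⟨n, hn, hs⟩
  exact ⟨Nat.find hex, (Nat.find_spec hex).1, (Nat.find_spec hex).2,
    fun k h₁ h₂ => Nat.find_min' hex ⟨h₁, h₂⟩⟩

theorem IsLeastPeriod.shift {s : ℕ → A} {n : ℕ} (h : IsLeastPeriod s n) (k : ℕ) :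
    IsLeastPeriod (fun i => s (i + k)) n :=
  ⟨h.pos, periodic_shift h.periodic k,
    fun m hm hp => h.le m hm (periodic_of_shift h.pos h.periodic hp)⟩

theorem IsLeastPeriod.unique {s : ℕ → A} {m n : ℕ} (h : IsLeastPeriod s m)
    (h' : IsLeastPeriod s n) : m = n :=
  le_antisymm (h.le _ h'.pos h'.periodic) (h'.le _ h.pos h.periodic)

theorem word_injective {s s' : ℕ → A} {n : ℕ} (hn : 0 < n) (hs : Function.Periodic s n)
    (hs' : Function.Periodic s' n) (h : word s n = word s' n) : s = s' := by
  funext i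
  have hi := Nat.mod_lt i hn
  rw [← hs.map_mod_nat i, ← hs'.map_mod_nat i, ← getElem_word s n (i % n) (by simpa),
    ← getElem_word s' n (i % n) (by simpa)]
  simp only [h]

theorem rotate_word {s : ℕ → A} {n : ℕ} (hs : Function.Periodic s n) (k : ℕ) :
    (word s n).rotate k = word (fun i => s (i + k)) n := by
  refine List.ext_getElem (by simp) fun i h₁ h₂ => ?_
  rw [List.getElem_rotate, getElem_word, getElem_word, length_word, hs.map_mod_nat]

/-- A periodic sequence is determined by one period, so classes of cycles become shift orbits of
sequences. -/
theorem coe_word_eq_iff {s s' : ℕ → A} {n n' : ℕ} (hn : 0 < n) (hs : Function.Periodic s n)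
    (hs' : Function.Periodic s' n') :
    (word s n : Cycle A) = word s' n' ↔ n = n' ∧ ∃ k, s' = fun i => s (i + k) := by
  rw [Cycle.coe_eq_coe]
  constructor
  · rintro ⟨k, hk⟩
    obtain rfl : n = n' := by simpa using congrArg List.length hk
    rw [rotate_word hs] at hk
    exact ⟨rfl, k, (word_injective hn (periodic_shift hs k) hs' hk).symm⟩
  · rintro ⟨rfl, k, rfl⟩
    exact ⟨k, rotate_word hs k⟩

theorem word_append_word {s : ℕ → A} {n : ℕ} (hs : Function.Periodic s n) (m : ℕ) :
    word s n ++ word s m = word s (n + m) := by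
  rw [word_add]; congr 2; funext i; exact (hs i).symm

theorem listPow_word {s : ℕ → A} {n : ℕ} (hs : Function.Periodic s n) (r : ℕ) :
    listPow (word s n) r = word s (n * r) := by
  induction r with
  | zero => simp [listPow, word]
  | succ r ih =>
    have : listPow (word s n) (r + 1) = word s n ++ listPow (word s n) r := by
      simp [listPow, List.replicate_succ]
    rw [this, ih, word_append_word hs]; congr 1; ring

theorem isChain_word_iff (R : A → A → Prop) (s : ℕ → A) (n : ℕ) :
    (word s n).IsChain R ↔ ∀ i, i + 1 < n → R (s i) (s (i + 1)) := by
  simp [List.isChain_iff_getElem, getElem_word]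

/-- The word `s 0, …, s (n - 1)` is a power of `B` exactly if `B` is an initial word of `s` whose
length is a period of `s` dividing `n`. -/
theorem eq_listPow_iff {s : ℕ → A} {n : ℕ} (hn : 0 < n) (hs : Function.Periodic s n)
    {B : List A} (hB : B ≠ []) :
    (∃ r, word s n = listPow B r) ↔
      B = word s B.length ∧ Function.Periodic s B.length ∧ B.length ∣ n := by
  constructor
  · rintro ⟨r, hr⟩
    obtain ⟨s', hs', hB'⟩ := exists_eq_word hB
    rw [hB', listPow_word hs'] at hr
    have hlen : n = B.length * r := by simpa using congrArg List.length hr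
    have hp : Function.Periodic s' (B.length * r) := by
      simpa [mul_comm] using hs'.nat_mul r
    rw [← hlen] at hr hp
    -- The periodic extension of `B` and `s` both have period `n` and agree on one period.
    obtain rfl := word_injective hn hs hp hr
    exact ⟨hB', hs', r, hlen⟩
  · rintro ⟨h₁, h₂, r, rfl⟩
    refine ⟨r, ?_⟩
    rw [h₁, listPow_word h₂, length_word]

theorem forall_of_periodic {s : ℕ → A} {n : ℕ} (hn : 0 < n) (hs : Function.Periodic s n)
    (R : A → A → Prop) (h : ∀ i, i < n → R (s i) (s (i + 1))) (i : ℕ) : R (s i) (s (i + 1)) := by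
  have := h (i % n) (Nat.mod_lt _ hn)
  rwa [hs.map_mod_nat, ← hs.map_mod_nat (i % n + 1), Nat.mod_add_mod, hs.map_mod_nat] at this

theorem chain_word_iff {s : ℕ → A} {n : ℕ} (hn : 0 < n) (hs : Function.Periodic s n)
    (R : A → A → Prop) :
    (word s n : Cycle A).Chain R ↔ ∀ i, R (s i) (s (i + 1)) := by
  obtain ⟨m, rfl⟩ : ∃ m, n = m + 1 := ⟨n - 1, by omega⟩
  rw [word_succ', Cycle.chain_coe_cons]
  have : s 0 :: (word (fun i => s (i + 1)) m ++ [s 0]) = word s (m + 1 + 1) := by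
    rw [word_succ s (m + 1), word_succ']
    simp [← hs 0]
  rw [this, isChain_word_iff]
  exact ⟨fun h => forall_of_periodic hn hs R fun i hi => h i (by omega), fun h i _ => h i⟩

end Words

/-! ### Prime cycles and prime alternating cycles as periodic sequences -/

section Sequences

variable {V : Type*} {G : SimpleGraph V}

/-- The arcs `s 0, s 1, …` form a path without backtracking. -/
structure IsNonBacktracking (s : ℕ → G.Dart) : Prop where
  adj : ∀ i, G.DartAdj (s i) (s (i + 1))
  symm_ne : ∀ i, (s (i + 1)).symm ≠ s i

theorem IsNonBacktracking.shift {s : ℕ → G.Dart} (h : IsNonBacktracking s) (k : ℕ) :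
    IsNonBacktracking fun i => s (i + k) := by
  constructor <;> intro i
  · simpa only [add_right_comm] using h.adj (i + k)
  · simpa only [add_right_comm] using h.symm_ne (i + k)

/-- A path without backtracking cannot be reversed arc by arc. -/
theorem IsNonBacktracking.ne_symm {s s' : ℕ → G.Dart} (h : IsNonBacktracking s)
    (h' : ∀ i, G.DartAdj (s' i) (s' (i + 1))) : s' ≠ fun i => (s i).symm := by
  rintro rfl
  have h₁ := h.adj 0
  have h₂ := h' 0
  -- Adjacency before and after reversal makes `s 1` the inverse of `s 0`.
  refine h.symm_ne 0 ?_
  simp only [DartAdj, zero_add] at h₁ h₂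
  ext
  · simpa using h₂.symm
  · simpa using h₁.symm

theorem isClosedPath_word_iff {s : ℕ → G.Dart} {n : ℕ} (hn : 0 < n)
    (hs : Function.Periodic s n) :
    IsClosedPath (word s n) ↔ ∀ i, G.DartAdj (s i) (s (i + 1)) := by
  rw [IsClosedPath, chain_word_iff hn hs, and_iff_right (word_ne_nil s hn)]

theorem isReducedCycle_word_iff {s : ℕ → G.Dart} {n : ℕ} (hn : 0 < n)
    (hs : Function.Periodic s n) : IsReducedCycle (word s n) ↔ IsNonBacktracking s := by
  rw [IsReducedCycle, isClosedPath_word_iff hn hs, word_append_word hs, NoBacktracking,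
    NoBacktracking, isChain_word_iff, isChain_word_iff]
  constructor
  · rintro ⟨h₁, -, h₂⟩
    -- The doubled word also contains the pair at `n - 1` and `n`, where the cycle closes up.
    exact ⟨h₁, forall_of_periodic hn hs (fun e f => f.symm ≠ e) fun i hi => h₂ i (by omega)⟩
  · rintro ⟨h₁, h₂⟩
    exact ⟨h₁, fun i _ => h₂ i, fun i _ => h₂ i⟩

/-- The least period divides `n`, so if smaller it yields a root; conversely the length of a root is
a period. -/
theorem isPrimeReducedCycle_word_iff {s : ℕ → G.Dart} {n : ℕ} (hn : 0 < n)
    (hs : Function.Periodic s n) :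
    IsPrimeReducedCycle (word s n) ↔ IsNonBacktracking s ∧ IsLeastPeriod s n := by
  rw [IsPrimeReducedCycle, isReducedCycle_word_iff hn hs]
  refine and_congr_right fun hnb => ⟨fun h => ?_, ?_⟩
  · obtain ⟨m, hm⟩ := exists_isLeastPeriod hn hs
    rcases (Nat.le_of_dvd hn (hm.dvd hs)).lt_or_eq with hlt | rfl
    · have hB := word_ne_nil s hm.pos
      obtain ⟨r, hr⟩ := (eq_listPow_iff hn hs hB).2 (by simpa using ⟨hm.periodic, hm.dvd hs⟩)
      exact absurd ⟨word s m, r, (isClosedPath_word_iff hm.pos hm.periodic).2 hnb.adj,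
        by simpa using hlt, hr⟩ h
    · exact hm
  · rintro h ⟨B, r, hB, hlt, hr⟩
    have hp := ((eq_listPow_iff hn hs hB.1).1 ⟨r, hr⟩).2.1
    exact absurd (h.le _ (List.length_pos_iff.2 hB.1) hp) (by simpa using hlt)

/-- The arc `e`, reversed unless `b`. -/
def orient (b : Bool) (e : G.Dart) : G.Dart := if b then e else e.symm

@[simp] theorem orient_orient (b : Bool) (e : G.Dart) : orient b (orient b e) = e := by
  cases b <;> simp [orient]

theorem orient_not (b : Bool) (e : G.Dart) : orient (!b) e = (orient b e).symm := by
  cases b <;> simp [orient]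

theorem altStart_eq (b : Bool) (e : G.Dart) : altStart b e = (orient b e).fst := by
  cases b <;> simp [orient, altStart]

theorem altEnd_eq (b : Bool) (e : G.Dart) : altEnd b e = (orient b e).snd := by
  cases b <;> simp [orient, altEnd]

/-- Reverse every other arc of a sequence; the first arc is kept exactly if `b`. -/
def alternate (b : Bool) (s : ℕ → G.Dart) (i : ℕ) : G.Dart := orient (b ^^ decide (Odd i)) (s i)

@[simp] theorem alternate_alternate (b : Bool) (s : ℕ → G.Dart) :
    alternate b (alternate b s) = s := by
  funext i; simp [alternate]

theorem alternate_injective (b : Bool) : Function.Injective (alternate (G := G) b) :=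
  Function.LeftInverse.injective (alternate_alternate b)

theorem alternate_shift_even (b : Bool) (s : ℕ → G.Dart) {k : ℕ} (hk : Even k) :
    alternate b (fun i => s (i + k)) = fun i => alternate b s (i + k) := by
  funext i; simp [alternate, Nat.odd_add, hk]

/-- An odd shift exchanges the kept and the reversed positions. -/
theorem alternate_shift_odd (b : Bool) (s : ℕ → G.Dart) {k : ℕ} (hk : Odd k) :
    alternate b (fun i => s (i + k)) = fun i => (alternate b s (i + k)).symm := by
  funext i
  simp only [alternate, Nat.odd_add, Nat.not_even_iff_odd.2 hk, iff_false, ← orient_not]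
  congr 1
  by_cases h : Odd i <;> cases b <;> simp [h]

theorem periodic_alternate {b : Bool} {s : ℕ → G.Dart} {n : ℕ} (hs : Function.Periodic s n)
    (hn : Even n) : Function.Periodic (alternate b s) n := fun i => by
  have := congrFun (alternate_shift_even b s hn) i
  rw [← this]
  simp only [alternate, hs i]

theorem periodic_of_alternate {b : Bool} {s : ℕ → G.Dart} {n : ℕ}
    (hs : Function.Periodic (alternate b s) n) (hn : Even n) : Function.Periodic s n := by
  simpa using periodic_alternate (b := b) hs hn

/-- Traversing an arc backwards is traversing its inverse forwards, so alternating walks are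
ordinary walks after `alternate`. -/
theorem isAltWalk_word_iff (b : Bool) (u w : V) (s : ℕ → G.Dart) (n : ℕ) :
    IsAltWalk b u w (word s (n + 1)) ↔
      (alternate b s 0).fst = u ∧
      (∀ i < n, G.DartAdj (alternate b s i) (alternate b s (i + 1))) ∧
      (alternate b s n).snd = w := by
  induction n generalizing w with
  | zero => simp [word, IsAltWalk, altStart_eq, altEnd_eq, alternate]
  | succ n ih =>
    rw [word_succ, isAltWalk_append_singleton, ih, length_word, altStart_eq, altEnd_eq]
    change ((_ ∧ _ ∧ _ = (alternate b s (n + 1)).fst) ∧ (alternate b s (n + 1)).snd = w) ↔ _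
    rw [Nat.forall_lt_succ_right]
    simp only [DartAdj, and_assoc]

theorem isAltCycleAt_word_iff {b : Bool} {v : V} {s : ℕ → G.Dart} {n : ℕ} (hn : 0 < n)
    (hs : Function.Periodic s n) :
    IsAltCycleAt b v (word s n) ↔ Even n ∧ (alternate b s 0).fst = v ∧
      ∀ i, G.DartAdj (alternate b s i) (alternate b s (i + 1)) := by
  obtain ⟨m, rfl⟩ : ∃ m, n = m + 1 := ⟨n - 1, by omega⟩
  have hhead (h) : (word s (m + 1)).head h = s 0 := by simp [word_succ']
  have hlast (h) : (word s (m + 1)).getLast h = s m := by simp [word_succ]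
  simp only [IsAltCycleAt, isAltWalk_word_iff, hhead, hlast,
    exists_prop_of_true (word_ne_nil s hn)]
  have loopless (f : G.Dart) : f.fst ≠ f.snd := f.fst_ne_snd
  constructor
  · rintro ⟨⟨h₀, hadj, hm⟩, hend⟩
    -- In odd length the first and last arcs are traversed in the same sense, so the endpoint
    -- condition would make one of them a loop.
    have heven : Even (m + 1) := by
      by_contra hodd
      have hm' : ¬ Odd m := fun h => hodd h.add_one
      cases b <;> simp only [alternate, orient, hm', decide_false, Bool.xor_false,
        Bool.false_eq_true, if_false, if_true, Nat.not_odd_zero] at h₀ hm <;>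
        rcases hend with h | h
      · exact loopless _ (h.1.trans h₀.symm)
      · exact loopless _ (hm.trans h.2.symm)
      · exact loopless _ (h.2.trans hm.symm)
      · exact loopless _ (h₀.trans h.1.symm)
    refine ⟨heven, h₀, ?_⟩
    have hper := periodic_alternate (b := b) hs heven
    refine forall_of_periodic hn hper G.DartAdj fun i hi => ?_
    rcases Nat.lt_succ_iff_lt_or_eq.1 hi with hi | rfl
    · exact hadj i hi
    · have := hper 0
      rw [zero_add] at this
      rw [DartAdj, this, hm, h₀]
  · rintro ⟨heven, h₀, hadj⟩
    have hper := periodic_alternate (b := b) hs heven 0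
    rw [zero_add] at hper
    have hm : (alternate b s m).snd = v := by rw [hadj m, hper, h₀]
    refine ⟨⟨h₀, fun i _ => hadj i, hm⟩, ?_⟩
    have hm' : Odd m := by
      rcases Nat.even_or_odd m with h | h
      · exact absurd heven (Nat.not_even_iff_odd.2 h.add_one)
      · exact h
    cases b <;> simp [alternate, orient, hm'] at h₀ hm
    · exact Or.inr ⟨h₀, hm⟩
    · exact Or.inl ⟨h₀, hm⟩

theorem isOutAltCycle_word_iff {s : ℕ → G.Dart} {n : ℕ} (hn : 0 < n)
    (hs : Function.Periodic s n) :
    IsOutAltCycle (word s n) ↔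
      Even n ∧ ∀ i, G.DartAdj (alternate true s i) (alternate true s (i + 1)) := by
  simp [IsOutAltCycle, isAltCycleAt_word_iff hn hs]

theorem isAltCycle_word_iff {s : ℕ → G.Dart} {n : ℕ} (hn : 0 < n)
    (hs : Function.Periodic s n) :
    IsAltCycle (word s n) ↔
      Even n ∧ ∃ b, ∀ i, G.DartAdj (alternate b s i) (alternate b s (i + 1)) := by
  simp [IsAltCycle, isAltCycleAt_word_iff hn hs]

/-- Neighbouring positions have opposite orientations, which absorbs the inverse. -/
theorem symm_alternate_ne_iff (b : Bool) (s : ℕ → G.Dart) (i : ℕ) :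
    (alternate b s (i + 1)).symm ≠ alternate b s i ↔ s (i + 1) ≠ s i := by
  have h : (b ^^ decide (Odd (i + 1))) = !(b ^^ decide (Odd i)) := by
    simp only [Nat.odd_add_one]
    by_cases h : Odd i <;> cases b <;> simp [h]
  rw [alternate, alternate, h, orient_not, Dart.symm_symm]
  refine not_congr ⟨fun h => ?_, fun h => by rw [h]⟩
  simpa using congrArg (orient (b ^^ decide (Odd i))) h

theorem isReducedAltCycle_word_iff {s : ℕ → G.Dart} {n : ℕ} (hn : 0 < n)
    (hs : Function.Periodic s n) :
    IsReducedAltCycle (word s n) ↔ Even n ∧ ∃ b, IsNonBacktracking (alternate b s) := by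
  rw [IsReducedAltCycle, isAltCycle_word_iff hn hs, isChain_word_iff]
  obtain ⟨m, rfl⟩ : ∃ m, n = m + 1 := ⟨n - 1, by omega⟩
  have hhead (h) : (word s (m + 1)).head h = s 0 := by simp [word_succ']
  have hlast (h) : (word s (m + 1)).getLast h = s m := by simp [word_succ]
  have hper : s (m + 1) = s 0 := by simpa using hs 0
  simp only [hhead, hlast]
  constructor
  · rintro ⟨⟨heven, b, hb⟩, h₁, h₂⟩
    refine ⟨heven, b, hb, fun i => ?_⟩
    rw [symm_alternate_ne_iff]
    refine forall_of_periodic hn hs (fun e f => f ≠ e) (fun i hi => ?_) i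
    rcases Nat.lt_succ_iff_lt_or_eq.1 hi with hi | rfl
    · exact h₁ i (by omega)
    -- The pair that closes the cycle up is the absence of a tail.
    · rw [hper]; exact (h₂ (word_ne_nil s hn)).symm
  · rintro ⟨heven, b, hb⟩
    have h (i) := (symm_alternate_ne_iff b s i).1 (hb.symm_ne i)
    exact ⟨⟨heven, b, hb.adj⟩, fun i _ => h i, fun _ => hper ▸ (h m).symm⟩

/-- The periods of a reduced alternating sequence are even. -/
theorem IsNonBacktracking.even_of_periodic {b : Bool} {s : ℕ → G.Dart}
    (h : IsNonBacktracking (alternate b s)) {k : ℕ} (hk : Function.Periodic s k) : Even k := by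
  by_contra hodd
  have hs : (fun i => s (i + k)) = s := funext hk
  have h₁ := alternate_shift_odd b s (Nat.not_even_iff_odd.1 hodd)
  rw [hs] at h₁
  -- With an odd period the walk would be the arc-by-arc reversal of its own shift.
  exact (h.shift k).ne_symm h.adj h₁

/-- Evenness needs no mention on the right: all periods are even, so the word of the least period is
itself an alternating cycle. -/
theorem isPrimeReducedAltCycle_word_iff {s : ℕ → G.Dart} {n : ℕ} (hn : 0 < n)
    (hs : Function.Periodic s n) :
    IsPrimeReducedAltCycle (word s n) ↔
      (∃ b, IsNonBacktracking (alternate b s)) ∧ IsLeastPeriod s n := by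
  rw [IsPrimeReducedAltCycle, isReducedAltCycle_word_iff hn hs]
  constructor
  · rintro ⟨⟨heven, b, hb⟩, h⟩
    refine ⟨⟨b, hb⟩, ?_⟩
    obtain ⟨m, hm⟩ := exists_isLeastPeriod hn hs
    rcases (Nat.le_of_dvd hn (hm.dvd hs)).lt_or_eq with hlt | rfl
    · have hB := word_ne_nil s hm.pos
      obtain ⟨r, hr⟩ := (eq_listPow_iff hn hs hB).2 (by simpa using ⟨hm.periodic, hm.dvd hs⟩)
      exact absurd ⟨word s m, r, (isAltCycle_word_iff hm.pos hm.periodic).2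
        ⟨hb.even_of_periodic hm.periodic, b, hb.adj⟩, by simpa using hlt, hr⟩ h
    · exact hm
  · rintro ⟨⟨b, hb⟩, h⟩
    refine ⟨⟨hb.even_of_periodic hs, b, hb⟩, ?_⟩
    rintro ⟨B, r, ⟨b', v, -, hB, -⟩, hlt, hr⟩
    have hp := ((eq_listPow_iff hn hs hB).1 ⟨r, hr⟩).2.1
    exact absurd (h.le _ (List.length_pos_iff.2 hB) hp) (by simpa using hlt)

end Sequences

/-! ### Prime alternating cycles from prime cycles -/

section Correspondence

variable {V : Type*} {G : SimpleGraph V}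

theorem PrimeCycleClass.coe_rep (c : PrimeCycleClass G) : (c.rep : Cycle G.Dart) = c.1 :=
  c.2.choose_spec.1

theorem PrimeCycleClass.rep_ne_nil (c : PrimeCycleClass G) : c.rep ≠ [] :=
  c.2.choose_spec.2.1.1.1

theorem PrimeAltCycleClass.coe_rep (c : PrimeAltCycleClass G) : (c.rep : Cycle G.Dart) = c.1 :=
  c.exists_out.choose_spec.1

theorem PrimeAltCycleClass.isOutAltCycle_rep (c : PrimeAltCycleClass G) : IsOutAltCycle c.rep :=
  c.exists_out.choose_spec.2

theorem PrimeAltCycleClass.rep_ne_nil (c : PrimeAltCycleClass G) : c.rep ≠ [] := by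
  obtain ⟨v, -, h, -⟩ := c.isOutAltCycle_rep
  exact h

/-- The periodic sequence of arcs of the representative of a class of prime cycles. -/
noncomputable def PrimeCycleClass.seq (c : PrimeCycleClass G) : ℕ → G.Dart :=
  (exists_eq_word c.rep_ne_nil).choose

theorem PrimeCycleClass.rep_eq (c : PrimeCycleClass G) : c.rep = word c.seq c.rep.length :=
  (exists_eq_word c.rep_ne_nil).choose_spec.2

theorem PrimeCycleClass.isNonBacktracking_and_isLeastPeriod (c : PrimeCycleClass G) :
    IsNonBacktracking c.seq ∧ IsLeastPeriod c.seq c.rep.length := by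
  have hper : Function.Periodic c.seq c.rep.length := (exists_eq_word c.rep_ne_nil).choose_spec.1
  rw [← isPrimeReducedCycle_word_iff (List.length_pos_iff.2 c.rep_ne_nil) hper, ← c.rep_eq]
  exact c.2.choose_spec.2

/-- Periods of the alternation are even, and even periods are shared with `s`. -/
theorem IsNonBacktracking.isLeastPeriod_alternate {b : Bool} {s : ℕ → G.Dart} {n : ℕ}
    (h : IsNonBacktracking s) (hn : IsLeastPeriod s n) :
    IsLeastPeriod (alternate b s) (n.lcm 2) := by
  have heven : Even (n.lcm 2) := even_iff_two_dvd.2 (Nat.dvd_lcm_right _ _)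
  refine ⟨Nat.lcm_pos hn.pos two_pos, periodic_alternate ?_ heven, fun k hk hp => ?_⟩
  · obtain ⟨r, hr⟩ := Nat.dvd_lcm_left n 2
    rw [hr, mul_comm]
    exact hn.periodic.nat_mul r
  · have hk2 : Even k :=
      IsNonBacktracking.even_of_periodic (b := b) (by rwa [alternate_alternate]) hp
    exact Nat.le_of_dvd hk
      (Nat.lcm_dvd (hn.dvd (periodic_of_alternate hp hk2)) (even_iff_two_dvd.1 hk2))

theorem PrimeCycleClass.isLeastPeriod_alternate (c : PrimeCycleClass G) (i : ℕ) :
    IsLeastPeriod (alternate true fun j => c.seq (j + i)) (c.rep.length.lcm 2) :=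
  (c.isNonBacktracking_and_isLeastPeriod.1.shift i).isLeastPeriod_alternate
    (c.isNonBacktracking_and_isLeastPeriod.2.shift i)

/-- Reverse every other arc of the shortest multiple of even length of a prime cycle, read from
its `i`-th arc on. -/
noncomputable def PrimeCycleClass.toAlt (c : PrimeCycleClass G) (i : ℕ) : PrimeAltCycleClass G :=
  ⟨(word (alternate true fun j => c.seq (j + i)) (c.rep.length.lcm 2) : List G.Dart), _, rfl, by
    have h := c.isLeastPeriod_alternate i
    refine (isPrimeReducedAltCycle_word_iff h.pos h.periodic).2 ⟨⟨true, ?_⟩, h⟩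
    rw [alternate_alternate]
    exact c.isNonBacktracking_and_isLeastPeriod.1.shift i⟩

theorem PrimeCycleClass.eq_of_seq_eq_shift {c c' : PrimeCycleClass G} {k k' : ℕ}
    (h : (fun i => c.seq (i + k)) = fun i => c'.seq (i + k')) : c = c' := by
  obtain ⟨-, hc⟩ := c.isNonBacktracking_and_isLeastPeriod
  obtain ⟨-, hc'⟩ := c'.isNonBacktracking_and_isLeastPeriod
  have hk := hc.shift k
  have hk' := hc'.shift k'
  have hlen : c.rep.length = c'.rep.length := by
    rw [h] at hk
    exact hk.unique hk'
  apply Subtype.ext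
  rw [← c.coe_rep, ← c'.coe_rep, c.rep_eq, c'.rep_eq]
  calc (word c.seq c.rep.length : Cycle G.Dart)
      = word (fun i => c.seq (i + k)) c.rep.length :=
        (coe_word_eq_iff hc.pos hc.periodic hk.periodic).2 ⟨rfl, k, rfl⟩
    _ = word c'.seq c'.rep.length := by
        rw [h, hlen]
        exact ((coe_word_eq_iff hc'.pos hc'.periodic hk'.periodic).2 ⟨rfl, k', rfl⟩).symm

/-- Two non-backtracking sequences whose alternations differ by a shift differ by the same shift,
which is even. -/
theorem IsNonBacktracking.shift_eq_of_alternate {s s' : ℕ → G.Dart} (hs : IsNonBacktracking s)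
    (hs' : ∀ i, G.DartAdj (s' i) (s' (i + 1))) {k : ℕ}
    (h : alternate true s' = fun i => alternate true s (i + k)) :
    Even k ∧ s' = fun i => s (i + k) := by
  rcases Nat.even_or_odd k with hk | hk
  · rw [← alternate_shift_even true s hk] at h
    exact ⟨hk, alternate_injective true h⟩
  · have h₂ := alternate_shift_odd true (alternate true s) hk
    rw [← h, alternate_alternate, alternate_alternate] at h₂
    exact absurd h₂ ((hs.shift k).ne_symm hs')

/-- Equal images differ by an even shift, so the cycles agree; for even length the parity of the
starting arc is then an invariant, and for odd length there is only one index. -/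
theorem toAlt_injective :
    Function.Injective fun x : Σ c : PrimeCycleClass G, Fin (c.rep.length.gcd 2) =>
      x.1.toAlt x.2 := by
  rintro ⟨c, i⟩ ⟨c', i'⟩ h
  have hi := c.isLeastPeriod_alternate i
  have hi' := c'.isLeastPeriod_alternate i'
  obtain ⟨-, k, hk⟩ := (coe_word_eq_iff hi.pos hi.periodic hi'.periodic).1 (congrArg Subtype.val h)
  obtain ⟨hnb, hc⟩ := c.isNonBacktracking_and_isLeastPeriod
  obtain ⟨heven, hshift⟩ := (hnb.shift i).shift_eq_of_alternate
    (c'.isNonBacktracking_and_isLeastPeriod.1.shift i').adj hk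
  simp only [add_assoc] at hshift
  obtain rfl := PrimeCycleClass.eq_of_seq_eq_shift hshift.symm
  congr 1
  apply Fin.ext
  rcases Nat.even_or_odd c.rep.length with hn | hn
  · have hg : c.rep.length.gcd 2 = 2 := Nat.gcd_eq_right (even_iff_two_dvd.1 hn)
    have h₁ := i.2
    have h₂ := i'.2
    have key {a b : ℕ} (hab : a ≤ b)
        (h : (fun j => c.seq (j + a)) = fun j => c.seq (j + b)) : Even (b - a) := by
      have hp : Function.Periodic (fun j => c.seq (j + a)) (b - a) := fun j => by
        simpa [add_assoc, Nat.sub_add_cancel hab] using (congrFun h j).symm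
      exact even_iff_two_dvd.2 ((even_iff_two_dvd.1 hn).trans
        (hc.dvd (periodic_of_shift hc.pos hc.periodic hp)))
    rcases le_total (i' : ℕ) (k + i) with hle | hle
    · have := key hle hshift
      grind
    · have := key hle hshift.symm
      grind
  · have hg : c.rep.length.gcd 2 = 1 := by
      simpa using (Nat.coprime_two_right.2 hn)
    have h₁ := i.2
    have h₂ := i'.2
    omega

theorem toAlt_surjective :
    Function.Surjective fun x : Σ c : PrimeCycleClass G, Fin (c.rep.length.gcd 2) =>
      x.1.toAlt x.2 := by
  intro a
  obtain ⟨C, hCa, hC⟩ := a.2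
  have hrep := a.rep_ne_nil
  obtain ⟨p, hp, hpr⟩ := exists_eq_word hrep
  have hpos := List.length_pos_iff.2 hrep
  have hC0 : C ≠ [] := hC.1.1.choose_spec.choose_spec.2.choose
  obtain ⟨q, hq, hqC⟩ := exists_eq_word hC0
  have hCpos := List.length_pos_iff.2 hC0
  have hrot : (word q C.length : Cycle G.Dart) = word p a.rep.length := by
    rw [← hpr, ← hqC, hCa, a.coe_rep]
  obtain ⟨hlen, k, hk⟩ := (coe_word_eq_iff hCpos hq hp).1 hrot
  rw [hqC, isPrimeReducedAltCycle_word_iff hCpos hq] at hC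
  obtain ⟨⟨b, hb⟩, hleast⟩ := hC
  -- `a.rep` is only known to start with an out-edge; primeness and reducedness are carried over
  -- from `C` by the shift.
  have hpleast : IsLeastPeriod p a.rep.length := by
    rw [hk, ← hlen]; exact hleast.shift k
  have hout := a.isOutAltCycle_rep
  rw [hpr, isOutAltCycle_word_iff hpos hp] at hout
  have hnb : IsNonBacktracking (alternate true p) := by
    refine ⟨hout.2, fun i => ?_⟩
    rw [symm_alternate_ne_iff, hk]
    simpa only [add_right_comm] using (symm_alternate_ne_iff b q (i + k)).1 (hb.symm_ne (i + k))
  obtain ⟨n, hn⟩ := exists_isLeastPeriod hpos (periodic_alternate (b := true) hp hout.1)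
  have hN : a.rep.length = n.lcm 2 := by
    have := hnb.isLeastPeriod_alternate (b := true) hn
    rw [alternate_alternate] at this
    exact hpleast.unique this
  let c : PrimeCycleClass G := ⟨(word (alternate true p) n : List G.Dart), _, rfl,
    (isPrimeReducedCycle_word_iff hn.pos hn.periodic).2 ⟨hnb, hn⟩⟩
  obtain ⟨-, hc⟩ := c.isNonBacktracking_and_isLeastPeriod
  have hrot' : (word (alternate true p) n : Cycle G.Dart) = word c.seq c.rep.length := by
    rw [← c.rep_eq, c.coe_rep]
  obtain ⟨hlen', l, hl⟩ := (coe_word_eq_iff hn.pos hn.periodic hc.periodic).1 hrot'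
  -- The representative of `c` may start at another arc, shifted by `l`. The index `i` makes the
  -- total shift even; for odd `n`, one of `l` and `l + n` is even already.
  obtain ⟨i, hi, m, hm, him⟩ : ∃ i, i < n.gcd 2 ∧ ∃ m, Even m ∧
      (fun j => alternate true p (j + i + l)) = fun j => alternate true p (j + m) := by
    rcases Nat.even_or_odd n with h | h
    · have hg : n.gcd 2 = 2 := Nat.gcd_eq_right (even_iff_two_dvd.1 h)
      exact ⟨l % 2, by omega, l % 2 + l, by grind, by simp only [add_assoc]⟩
    · have hg : n.gcd 2 = 1 := by
        simpa using (Nat.coprime_two_right.2 h)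
      rcases Nat.even_or_odd l with h' | h'
      · exact ⟨0, by omega, l, h', by simp⟩
      · refine ⟨0, by omega, l + n, h'.add_odd h, ?_⟩
        funext j
        rw [← add_assoc]
        exact (hn.periodic _).symm
  refine ⟨⟨c, i, hlen' ▸ hi⟩, Subtype.ext ?_⟩
  have hci := c.isLeastPeriod_alternate i
  change ((word _ _ : List G.Dart) : Cycle G.Dart) = a.1
  rw [← a.coe_rep, hpr]
  refine ((coe_word_eq_iff hpos hp hci.periodic).2 ⟨by rw [hN, hlen'], m, ?_⟩).symm
  rw [hl, him, alternate_shift_even true _ hm, alternate_alternate]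

/-- Classes of prime alternating cycles correspond to classes of prime cycles, two to each class of
even length and one to each class of odd length. -/
noncomputable def altEquiv (G : SimpleGraph V) :
    (Σ c : PrimeCycleClass G, Fin (c.rep.length.gcd 2)) ≃ PrimeAltCycleClass G :=
  Equiv.ofBijective _ ⟨toAlt_injective, toAlt_surjective⟩

/-- The alternate arcs of the representative of `c.toAlt i`, reversed back, run through the cycle
`c`. -/
theorem PrimeCycleClass.exists_rep_toAlt (c : PrimeCycleClass G) (i : ℕ) :
    ∃ k, (c.toAlt i).rep =
      word (alternate true fun j => c.seq (j + k)) (c.rep.length.lcm 2) := by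
  obtain ⟨p, hp, hpr⟩ := exists_eq_word (c.toAlt i).rep_ne_nil
  have hi := c.isLeastPeriod_alternate i
  have hrot : (word (alternate true fun j => c.seq (j + i)) (c.rep.length.lcm 2) :
      Cycle G.Dart) = word p (c.toAlt i).rep.length := by
    rw [← hpr, (c.toAlt i).coe_rep]; rfl
  obtain ⟨hlen, k, hk⟩ := (coe_word_eq_iff hi.pos hi.periodic hp).1 hrot
  have hout := (c.toAlt i).isOutAltCycle_rep
  rw [hpr, isOutAltCycle_word_iff (List.length_pos_iff.2 (c.toAlt i).rep_ne_nil) hp] at hout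
  obtain ⟨-, h⟩ := (c.isNonBacktracking_and_isLeastPeriod.1.shift i).shift_eq_of_alternate
    hout.2 (by rw [alternate_alternate, hk])
  refine ⟨k + i, ?_⟩
  rw [hpr, ← hlen]
  congr 1
  rw [← alternate_alternate true p, h]
  simp only [add_assoc]

end Correspondence

/-! ### Euler factors -/

section Factors

variable {V : Type*} {G : SimpleGraph V} {Γ : Type*} [Group Γ] {d : ℕ}
  {R : Type*} [CommRing R] [Algebra ℂ R]

theorem prod_word_mul {M : Type*} [Monoid M] {f : ℕ → M} {n : ℕ} (hf : Function.Periodic f n)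
    (r : ℕ) : (word f (n * r)).prod = (word f n).prod ^ r := by
  rw [← listPow_word hf, listPow, List.prod_flatten]
  simp

/-- Moving the first letter to the end conjugates the product by that letter. -/
theorem isConj_prod_word_shift {f : ℕ → Γ} {n : ℕ} (hf : Function.Periodic f n) (k : ℕ) :
    IsConj (word (fun i => f (i + k)) n).prod (word f n).prod := by
  induction k with
  | zero => exact IsConj.refl _
  | succ k ih =>
    refine IsConj.trans ?_ ih
    set g : ℕ → Γ := fun i => f (i + k)
    have hg : Function.Periodic g n := periodic_shift hf k
    have h : g 0 * (word (fun i => g (i + 1)) n).prod = (word g n).prod * g 0 := by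
      rw [← List.prod_cons, ← word_succ', word_succ, List.prod_append, List.prod_singleton]
      congr 1
      simpa using hg 0
    have hfg : (fun i => f (i + (k + 1))) = fun i => g (i + 1) := by
      funext i; simp only [g]; congr 1; ring
    rw [hfg, isConj_iff]
    exact ⟨g 0, by rw [h, mul_inv_cancel_right]⟩

theorem map_word {A B : Type*} (f : A → B) (s : ℕ → A) (n : ℕ) :
    (word s n).map f = word (fun i => f (s i)) n := by
  simp [word]

/-- The inverted voltages are the voltages of the reversed arcs. -/
theorem alternatingProd_word {α : G.Dart → Γ} (hα : IsOrdinaryVoltage α) (s : ℕ → G.Dart) (n : ℕ) :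
    ((word s n).map α).alternatingProd = ((word (alternate true s) n).map α).prod := by
  simp only [map_word]
  induction n using Nat.twoStepInduction generalizing s with
  | zero => simp [word]
  | one => simp [word, alternate, orient]
  | more n ih _ =>
    have h0 : α (alternate true s 0) = α (s 0) := by simp [alternate, orient]
    have h1 : α (alternate true s (0 + 1)) = (α (s (0 + 1)))⁻¹ := by
      simp [alternate, orient, hα (s 1)]
    rw [word_succ', word_succ', word_succ', word_succ', List.alternatingProd_cons_cons',
      List.prod_cons, List.prod_cons, ih fun i => s (i + 1 + 1), h0, h1, mul_assoc]
    congr 4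
    funext i
    exact congrArg α (congrFun (alternate_shift_even true s even_two) i)

theorem cycleHolonomy_eq (ρ : Γ →* Matrix.unitaryGroup (Fin d) ℂ) (α : G.Dart → Γ)
    (C : List G.Dart) : cycleHolonomy ρ α C = ρ (C.map α).prod := by
  simp [cycleHolonomy, map_list_prod, Function.comp_def]

theorem altHolonomy_eq (ρ : Γ →* Matrix.unitaryGroup (Fin d) ℂ) (α : G.Dart → Γ)
    (C : List G.Dart) : altHolonomy ρ α C = ρ (C.map α).alternatingProd := by
  rw [altHolonomy]
  induction C using List.twoStepInduction with
  | nil => simp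
  | singleton => simp
  | cons_cons a b l ih _ => simp [List.alternatingProd_cons_cons', ih]

theorem eulerFactor_eq_of_isConj {U U' : Matrix.unitaryGroup (Fin d) ℂ} (h : IsConj U U') (n : ℕ)
    (t : R) : eulerFactor (U : Matrix (Fin d) (Fin d) ℂ) n t = eulerFactor U'.1 n t := by
  obtain ⟨W, rfl⟩ := isConj_iff.1 h
  let φ := (algebraMap ℂ R).mapMatrix (m := Fin d)
  have hW : φ W.1 * φ (W⁻¹).1 = 1 := by
    rw [← map_mul, ← Submonoid.coe_mul, mul_inv_cancel, Submonoid.coe_one, map_one]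
  have hdet := congrArg Matrix.det hW
  rw [Matrix.det_mul, Matrix.det_one] at hdet
  have hfac : 1 - t ^ n • φ (W * U * W⁻¹).1 = φ W.1 * (1 - t ^ n • φ U.1) * φ (W⁻¹).1 := by
    rw [mul_sub, sub_mul, mul_one, hW, Submonoid.coe_mul, Submonoid.coe_mul, map_mul, map_mul]
    simp
  change Ring.inverse (1 - t ^ n • φ U.1).det = Ring.inverse (1 - t ^ n • φ (W * U * W⁻¹).1).det
  rw [hfac, Matrix.det_mul, Matrix.det_mul, mul_right_comm, hdet, one_mul]

/-- With `N = tⁿM` this is `1 - N² = (1 + N)(1 - N)`; oddness gives `(-t)ⁿ = -tⁿ`. -/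
theorem eulerFactor_sq (M : Matrix (Fin d) (Fin d) ℂ) {n : ℕ} (hn : Odd n) (t : R) :
    eulerFactor (M ^ 2) (n * 2) t = eulerFactor M n t * eulerFactor M n (-t) := by
  rw [eulerFactor, eulerFactor, eulerFactor, ← Ring.mul_inverse_rev, ← Matrix.det_mul,
    hn.neg_pow, pow_mul]
  congr 2
  change 1 - _ • (algebraMap ℂ R).mapMatrix (M ^ 2) = _
  rw [map_pow]
  change _ = (1 - (-t ^ n) • (algebraMap ℂ R).mapMatrix M) *
    (1 - t ^ n • (algebraMap ℂ R).mapMatrix M)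
  rw [neg_smul, sub_neg_eq_add, ← smul_pow]
  generalize t ^ n • (algebraMap ℂ R).mapMatrix M = N
  noncomm_ring

/-- The alternating holonomy is, up to conjugation, that of the cycle run `r` times; `r` is `1` or
`2` by parity. -/
theorem altFactor_toAlt {α : G.Dart → Γ} (hα : IsOrdinaryVoltage α)
    (ρ : Γ →* Matrix.unitaryGroup (Fin d) ℂ) (t : R) (c : PrimeCycleClass G) (i : ℕ) {r : ℕ}
    (hr : c.rep.length.lcm 2 = c.rep.length * r) :
    altFactor ρ α t (c.toAlt i) =
      eulerFactor ((cycleHolonomy ρ α c.rep : Matrix (Fin d) (Fin d) ℂ) ^ r)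
        (c.rep.length.lcm 2) t := by
  obtain ⟨k, hk⟩ := c.exists_rep_toAlt i
  have hper : Function.Periodic (fun j => α (c.seq j)) c.rep.length :=
    fun j => congrArg α (c.isNonBacktracking_and_isLeastPeriod.2.periodic j)
  have hconj := isConj_prod_word_shift (f := fun j => α (c.seq j)) (n := c.rep.length * r)
    (by simpa [mul_comm] using hper.nat_mul r) k
  rw [prod_word_mul hper, ← map_word α c.seq, ← c.rep_eq] at hconj
  have h := ρ.map_isConj hconj
  rw [altFactor, altHolonomy_eq, hk, alternatingProd_word hα, alternate_alternate, length_word,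
    map_word, hr, cycleHolonomy_eq, ← SubmonoidClass.coe_pow, ← map_pow]
  exact eulerFactor_eq_of_isConj h _ t

/-- The product of the alternating factors belonging to a class of prime cycles. -/
theorem prod_altFactor_toAlt {α : G.Dart → Γ} (hα : IsOrdinaryVoltage α)
    (ρ : Γ →* Matrix.unitaryGroup (Fin d) ℂ) (t : R) (c : PrimeCycleClass G) :
    ∏ i : Fin (c.rep.length.gcd 2), altFactor ρ α t (c.toAlt i) =
      iharaFactor ρ α t c * iharaFactor ρ α (-t) c := by
  rcases Nat.even_or_odd c.rep.length with h | h
  · have hg : c.rep.length.gcd 2 = 2 := Nat.gcd_eq_right (even_iff_two_dvd.1 h)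
    have hl : c.rep.length.lcm 2 = c.rep.length := Nat.lcm_eq_left (even_iff_two_dvd.1 h)
    have hr : c.rep.length.lcm 2 = c.rep.length * 1 := by rw [hl, mul_one]
    have hneg : iharaFactor ρ α (-t) c = iharaFactor ρ α t c := by
      simp only [iharaFactor, eulerFactor, h.neg_pow]
    simp only [altFactor_toAlt hα ρ t c _ hr, hl, pow_one, Finset.prod_const, Finset.card_univ,
      Fintype.card_fin, hg, hneg, pow_two]
    rfl
  · have hg : c.rep.length.gcd 2 = 1 := by simpa using Nat.coprime_two_right.2 h
    have hl : c.rep.length.lcm 2 = c.rep.length * 2 := (Nat.coprime_two_right.2 h).lcm_eq_mul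
    simp only [altFactor_toAlt hα ρ t c _ hl, hl, eulerFactor_sq _ h, Finset.prod_const,
      Finset.card_univ, Fintype.card_fin, hg, pow_one]
    rfl

/-- The factorization of the alternating `L`-function, given convergence of the products. -/
theorem altL_eq_of_multipliable [TopologicalSpace R] [T3Space R] [ContinuousMul R]
    {α : G.Dart → Γ} (hα : IsOrdinaryVoltage α) (ρ : Γ →* Matrix.unitaryGroup (Fin d) ℂ) (t : R)
    (ha : Multipliable (altFactor ρ α t)) (h₁ : Multipliable (iharaFactor ρ α t))
    (h₂ : Multipliable (iharaFactor ρ α (-t))) :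
    altL ρ α t = iharaL ρ α t * iharaL ρ α (-t) := by
  -- The product is regrouped along the finite fibres over classes of cycles.
  have h := ((altEquiv G).hasProd_iff.2 ha.hasProd).sigma fun c => hasProd_fintype _
  have hc (c : PrimeCycleClass G) := prod_altFactor_toAlt hα ρ t c
  rw [iharaL, iharaL, ← h₁.tprod_mul h₂]
  refine h.tprod_eq.symm.trans (tprod_congr hc)

end Factors

/-! ### Convergence -/

section Convergence

/-- A family `1 + f i` of power series is multipliable if only finitely many `f i` have order at
most `n`, for each `n`. -/
theorem multipliable_one_add_of_finite_order_le {ι S : Type*} [CommSemiring S]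
    [TopologicalSpace S] {f : ι → PowerSeries S}
    (h : ∀ n : ℕ, {i | (f i).order ≤ n}.Finite) : Multipliable fun i => 1 + f i := by
  refine multipliable_one_add_of_summable_prod
    ((PowerSeries.WithPiTopology.summable_iff_summable_coeff _).2 fun n =>
      summable_of_hasFiniteSupport ?_)
  refine (h n).toFinset.powerset.finite_toSet.subset fun s hs => ?_
  simp only [Finset.coe_powerset, Set.mem_preimage, Set.mem_powerset_iff]
  intro i hi
  simp only [Set.Finite.coe_toFinset, Set.mem_ofPred_eq]
  by_contra hlt
  -- One factor of order above `n` makes the `n`-th coefficient of the finite product vanish.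
  refine hs (PowerSeries.coeff_of_lt_order _ ((not_le.1 hlt).trans_le ?_))
  exact (Finset.single_le_sum (f := fun i => (f i).order) (by simp) hi).trans
    (PowerSeries.le_order_prod _ _)

variable {d : ℕ} {A ι : Type*} [Finite A] {C : ι → List A}

theorem finite_length_le (hC : Function.Injective C) (n : ℕ) :
    {i | (C i).length ≤ n}.Finite :=
  Set.Finite.preimage hC.injOn (List.finite_length_le A n)

/-- Modulo `s` the matrix is the identity. -/
theorem dvd_det_one_sub_smul_sub_one {R : Type*} [CommRing R] (s : R)
    (A : Matrix (Fin d) (Fin d) R) : s ∣ (1 - s • A).det - 1 := by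
  rw [← Ideal.mem_span_singleton, ← Ideal.Quotient.eq, RingHom.map_det, map_one]
  have hs : Ideal.Quotient.mk (Ideal.span {s}) s = 0 :=
    Ideal.Quotient.eq_zero_iff_mem.2 (Ideal.mem_span_singleton_self s)
  have h0 : (Ideal.Quotient.mk (Ideal.span {s})).mapMatrix (s • A) = 0 := by
    ext i j
    simp [hs]
  rw [map_sub, map_one, h0, sub_zero, Matrix.det_one]

theorem X_pow_dvd_eulerFactor_sub_one (M : Matrix (Fin d) (Fin d) ℂ) {n : ℕ} (hn : n ≠ 0)
    {t : PowerSeries ℂ} (ht : PowerSeries.X ∣ t) : PowerSeries.X ^ n ∣ eulerFactor M n t - 1 := by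
  set D := (1 - t ^ n • M.map (algebraMap ℂ (PowerSeries ℂ))).det with hD
  have hdvd : PowerSeries.X ^ n ∣ D - 1 :=
    (pow_dvd_pow_of_dvd ht n).trans (dvd_det_one_sub_smul_sub_one _ _)
  have hunit : IsUnit D := by
    have h0 := PowerSeries.X_dvd_iff.1 ((dvd_pow_self _ hn).trans hdvd)
    rw [map_sub, map_one, sub_eq_zero] at h0
    rw [PowerSeries.isUnit_iff_constantCoeff, h0]
    exact isUnit_one
  have h : eulerFactor M n t - 1 = -(Ring.inverse D * (D - 1)) := by
    rw [mul_sub, Ring.inverse_mul_cancel _ hunit, eulerFactor, ← hD]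
    ring
  rw [h, dvd_neg]
  exact hdvd.mul_left _

theorem multipliable_eulerFactor_powerSeries (hC : Function.Injective C) (hne : ∀ i, C i ≠ [])
    (M : ι → Matrix (Fin d) (Fin d) ℂ) {t : PowerSeries ℂ}
    (ht : PowerSeries.X ∣ t) : Multipliable fun i => eulerFactor (M i) (C i).length t := by
  have h := multipliable_one_add_of_finite_order_le
    (f := fun i => eulerFactor (M i) (C i).length t - 1) fun n =>
      (finite_length_le hC n).subset fun i hi => Nat.cast_le.1
        ((PowerSeries.nat_le_order _ _ (PowerSeries.X_pow_dvd_iff.1 <| X_pow_dvd_eulerFactor_sub_one (M i)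
          (List.length_pos_iff.2 (hne i)).ne' ht)).trans hi)
  simpa using h

/-- There are `Nat.card A ^ n` words of length `n`, so the sum is a geometric series. -/
theorem summable_pow_length {x : ℝ} (hx : 0 ≤ x) (h : x * Nat.card A < 1) :
    Summable fun l : List A => x ^ l.length := by
  classical
  have := Fintype.ofFinite A
  rw [← List.equivSigmaTuple.symm.summable_iff]
  refine (summable_sigma_of_nonneg fun _ => pow_nonneg hx _).2 ⟨fun n => Summable.of_finite, ?_⟩
  have : Summable fun n : ℕ => (x * Nat.card A) ^ n :=
    summable_geometric_of_lt_one (by positivity) h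
  convert this using 2 with n
  simp [List.equivSigmaTuple, mul_pow, mul_comm]

/-- The factor is differentiable at `0` with value `1` there. By `eulerFactor_pow`, `z = tⁿ` covers
every length. -/
theorem exists_norm_eulerFactor_sub_one_le (M : Matrix (Fin d) (Fin d) ℂ) :
    ∃ K : ℝ, ∀ᶠ z : ℂ in nhds 0, ‖eulerFactor M 1 z - 1‖ ≤ K * ‖z‖ := by
  have hdet : Differentiable ℂ fun z : ℂ => (1 - z • M).det := by
    simp only [Matrix.det_apply, Matrix.sub_apply, Matrix.smul_apply]
    fun_prop
  have h : (fun z : ℂ => eulerFactor M 1 z) = fun z => ((1 - z • M).det)⁻¹ := by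
    funext z
    rw [eulerFactor, Ring.inverse_eq_inv', pow_one]
    rfl
  have hdiff : DifferentiableAt ℂ (fun z : ℂ => eulerFactor M 1 z) 0 := by
    rw [h]
    exact hdet.differentiableAt.inv (by simp)
  obtain ⟨K, hK⟩ := hdiff.isBigO_sub.bound
  exact ⟨K, hK.mono fun z hz => by simpa [eulerFactor] using hz⟩

theorem eulerFactor_pow {R : Type*} [CommRing R] [Algebra ℂ R] (M : Matrix (Fin d) (Fin d) ℂ)
    (n : ℕ) (t : R) : eulerFactor M n t = eulerFactor M 1 (t ^ n) := by
  simp [eulerFactor]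

theorem exists_multipliable_eulerFactor (hC : Function.Injective C) (hne : ∀ i, C i ≠ [])
    {B : Type*} [Finite B] (M : B → Matrix (Fin d) (Fin d) ℂ) (g : ι → B) :
    ∃ r : ℝ, 0 < r ∧ ∀ t : ℂ, ‖t‖ < r →
      Multipliable fun i => eulerFactor (M (g i)) (C i).length t := by
  choose K hK using fun b => exists_norm_eulerFactor_sub_one_le (M b)
  -- Finiteness of `B` makes the constant and the radius uniform.
  obtain ⟨L, hL⟩ := Set.finite_range K |>.bddAbove
  obtain ⟨ε, hε, h⟩ := Metric.eventually_nhds_iff.1 (Filter.eventually_all.2 hK)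
  -- The bound `1` gives `‖tⁿ‖ ≤ ‖t‖`, `ε` gives the estimate of the factors, and the last term
  -- gives `‖t‖ * Nat.card A < 1`.
  refine ⟨min (min 1 ε) (1 / (Nat.card A + 1)), by positivity, fun t ht => ?_⟩
  simp only [lt_min_iff] at ht
  obtain ⟨⟨ht1, htε⟩, htA⟩ := ht
  have hs : Summable fun l : List A => ‖t‖ ^ l.length := by
    refine summable_pow_length (norm_nonneg t) ?_
    rw [lt_div_iff₀ (by positivity)] at htA
    nlinarith [norm_nonneg t]
  have hb : Summable fun i => ‖eulerFactor (M (g i)) (C i).length t - 1‖ := by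
    refine Summable.of_nonneg_of_le (fun _ => norm_nonneg _) (fun i => ?_)
      ((hs.comp_injective hC).mul_left L)
    have hle : ‖t ^ (C i).length‖ ≤ ‖t‖ := by
      rw [norm_pow]
      exact pow_le_of_le_one (norm_nonneg t) ht1.le (List.length_pos_iff.2 (hne i)).ne'
    have := h (y := t ^ (C i).length) (by simpa only [dist_zero_right] using hle.trans_lt htε) (g i)
    rw [eulerFactor_pow]
    refine this.trans ?_
    rw [norm_pow]
    exact mul_le_mul_of_nonneg_right (hL ⟨g i, rfl⟩) (by positivity)
  simpa using multipliable_one_add_of_summable hb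

end Convergence

/-! ### Convergence of the `L`-functions -/

section Classes

variable {V : Type*} {G : SimpleGraph V}

theorem PrimeCycleClass.rep_injective :
    Function.Injective (PrimeCycleClass.rep : PrimeCycleClass G → List G.Dart) := fun c c' h =>
  Subtype.ext (by rw [← c.coe_rep, ← c'.coe_rep, h])

theorem PrimeAltCycleClass.rep_injective :
    Function.Injective (PrimeAltCycleClass.rep : PrimeAltCycleClass G → List G.Dart) :=
  fun c c' h => Subtype.ext (by rw [← c.coe_rep, ← c'.coe_rep, h])

variable [Finite V]

theorem finite_dart : Finite G.Dart :=
  Finite.of_injective _ (Dart.toProd_injective (G := G))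

variable {Γ : Type*} [Group Γ] (α : G.Dart → Γ) {d : ℕ}
  (ρ : Γ →* Matrix.unitaryGroup (Fin d) ℂ)

theorem multipliable_iharaFactor_powerSeries {t : PowerSeries ℂ} (ht : PowerSeries.X ∣ t) :
    Multipliable (iharaFactor ρ α t) :=
  have := finite_dart (G := G)
  multipliable_eulerFactor_powerSeries PrimeCycleClass.rep_injective PrimeCycleClass.rep_ne_nil _ ht

theorem multipliable_altFactor_powerSeries {t : PowerSeries ℂ} (ht : PowerSeries.X ∣ t) :
    Multipliable (altFactor ρ α t) :=
  have := finite_dart (G := G)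
  multipliable_eulerFactor_powerSeries PrimeAltCycleClass.rep_injective
    PrimeAltCycleClass.rep_ne_nil _ ht

theorem exists_multipliable_iharaFactor [Finite Γ] :
    ∃ r : ℝ, 0 < r ∧ ∀ t : ℂ, ‖t‖ < r → Multipliable (iharaFactor ρ α t) := by
  have := finite_dart (G := G)
  -- The holonomy is the image under `ρ` of an element of the finite group `Γ`.
  have h := exists_multipliable_eulerFactor PrimeCycleClass.rep_injective
    (PrimeCycleClass.rep_ne_nil (G := G)) (fun g : Γ => (ρ g).1) fun c => (c.rep.map α).prod
  simp only [← cycleHolonomy_eq] at h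
  exact h

theorem exists_multipliable_altFactor [Finite Γ] :
    ∃ r : ℝ, 0 < r ∧ ∀ t : ℂ, ‖t‖ < r → Multipliable (altFactor ρ α t) := by
  have := finite_dart (G := G)
  have h := exists_multipliable_eulerFactor PrimeAltCycleClass.rep_injective
    (PrimeAltCycleClass.rep_ne_nil (G := G)) (fun g : Γ => (ρ g).1)
    fun c => (c.rep.map α).alternatingProd
  simp only [← altHolonomy_eq] at h
  exact h

end Classes

end SimpleGraph

/-- The identity holds for all complex `t` near `0`, where the products converge, and as an identity
of formal power series in `t` (products taken in the topology of coefficientwise convergence). -/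
theorem theorem18 {V : Type*} [Finite V] (G : SimpleGraph V) (hG : G.Connected)
    {Γ : Type*} [Group Γ] [Finite Γ] (α : G.Dart → Γ) (hα : SimpleGraph.IsOrdinaryVoltage α)
    {d : ℕ} (ρ : Γ →* Matrix.unitaryGroup (Fin d) ℂ) :
    (∃ r : ℝ, 0 < r ∧ ∀ t : ℂ, ‖t‖ < r →
      Multipliable (SimpleGraph.altFactor ρ α t) ∧
      Multipliable (SimpleGraph.iharaFactor ρ α t) ∧
      Multipliable (SimpleGraph.iharaFactor ρ α (-t)) ∧
      SimpleGraph.altL ρ α t = SimpleGraph.iharaL ρ α t * SimpleGraph.iharaL ρ α (-t)) ∧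
    (Multipliable (SimpleGraph.altFactor ρ α (PowerSeries.X : PowerSeries ℂ)) ∧
      Multipliable (SimpleGraph.iharaFactor ρ α (PowerSeries.X : PowerSeries ℂ)) ∧
      Multipliable (SimpleGraph.iharaFactor ρ α (-PowerSeries.X : PowerSeries ℂ)) ∧
      SimpleGraph.altL ρ α (PowerSeries.X : PowerSeries ℂ) =
        SimpleGraph.iharaL ρ α (PowerSeries.X : PowerSeries ℂ) *
          SimpleGraph.iharaL ρ α (-PowerSeries.X : PowerSeries ℂ)) := by
  constructor
  · obtain ⟨r₁, hr₁, h₁⟩ := SimpleGraph.exists_multipliable_iharaFactor α ρ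
    obtain ⟨r₂, hr₂, h₂⟩ := SimpleGraph.exists_multipliable_altFactor α ρ
    refine ⟨min r₁ r₂, lt_min hr₁ hr₂, fun t ht => ?_⟩
    have ha := h₂ t (ht.trans_le (min_le_right _ _))
    have hp := h₁ t (ht.trans_le (min_le_left _ _))
    have hm := h₁ (-t) (by simpa using ht.trans_le (min_le_left _ _))
    exact ⟨ha, hp, hm, SimpleGraph.altL_eq_of_multipliable hα ρ t ha hp hm⟩
  · have ha := SimpleGraph.multipliable_altFactor_powerSeries α ρ (dvd_refl PowerSeries.X)
    have hp := SimpleGraph.multipliable_iharaFactor_powerSeries α ρ (dvd_refl PowerSeries.X)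
    have hm := SimpleGraph.multipliable_iharaFactor_powerSeries α ρ
      ((dvd_neg (a := PowerSeries.X)).2 dvd_rfl)
    -- Regrouping needs a regular space; the coefficientwise topology is a product of copies of `ℂ`.
    have : RegularSpace (PowerSeries ℂ) := inferInstanceAs (RegularSpace ((Unit →₀ ℕ) → ℂ))
    exact ⟨ha, hp, hm, SimpleGraph.altL_eq_of_multipliable hα ρ _ ha hp hm⟩
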